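/- Let $n \geq 2$ be an integer. There exist a constant $C_n > 0$, depending only on $n$, and an integer $m_0$ (which may depend on $n$) such that for every integer $m \geq m_0$ the following holds. Let $a_1, \dots, a_m$ be independent random points, each uniformly distributed (with respect to normalized surface measure) on the unit sphere $S^{n-1} = \{x \in \mathbb{R}^n : \|x\| = 1\}$, let $P$ be the convex hull of $\{a_1, \dots, a_m\}$ in $\mathbb{R}^n$, and let $f(P)$ be the number of facets of $P$, that is, of nonempty faces of $P$ whose dimension is $\dim P - 1$. Then $f(P)$ is a random variable (it is measurable up to a null set), and $$\mathbb{E}[f(P)] \;\leq\; C_n \, (\log m)^{n-1} \, m .$$ -/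

import Mathlib

open MeasureTheory Filter
open scoped ENNReal

namespace RandomPolytope

/-- The unit sphere `S^{n-1}` in the Euclidean space `ℝⁿ`. -/
abbrev UnitSphere (n : ℕ) : Type :=
  Metric.sphere (0 : EuclideanSpace ℝ (Fin n)) 1

/-- The uniform probability measure on `S^{n-1}`: surface measure divided by its total mass. -/
noncomputable def uniformSphere (n : ℕ) : Measure (UnitSphere n) :=
  ((volume : Measure (EuclideanSpace ℝ (Fin n))).toSphere Set.univ)⁻¹ •
    (volume : Measure (EuclideanSpace ℝ (Fin n))).toSphere

theorem isProbabilityMeasure_uniformSphere (n : ℕ) (hn : 1 ≤ n) :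
    IsProbabilityMeasure (uniformSphere n) := by
  have : Nonempty (Fin n) := ⟨⟨0, hn⟩⟩
  refine ⟨?_⟩
  rw [uniformSphere, Measure.smul_apply, smul_eq_mul]
  refine ENNReal.inv_mul_cancel ?_ (measure_ne_top _ _)
  rw [Ne, Measure.measure_univ_eq_zero]
  exact Measure.toSphere_ne_zero _

/-- The joint law of `m` independent uniform random points on `S^{n-1}`. -/
noncomputable def randomPoints (n m : ℕ) : Measure (Fin m → UnitSphere n) :=
  Measure.pi fun _ => uniformSphere n

/-- The convex hull in `ℝⁿ` of `m` points of the unit sphere. -/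
def polytope {n m : ℕ} (a : Fin m → UnitSphere n) : Set (EuclideanSpace ℝ (Fin n)) :=
  convexHull ℝ (Set.range fun i => (a i : EuclideanSpace ℝ (Fin n)))

/-- The facets of a polytope `P`: its nonempty faces (sets of maximizers over `P` of a linear
functional) whose dimension is one less than that of `P`, where the dimension of a set is that of
its affine span. -/
def facets {n : ℕ} (P : Set (EuclideanSpace ℝ (Fin n))) :
    Set (Set (EuclideanSpace ℝ (Fin n))) :=
  {F | F.Nonempty ∧ IsExposed ℝ P F ∧
    Module.finrank ℝ (vectorSpan ℝ F) + 1 = Module.finrank ℝ (vectorSpan ℝ P)}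

/-- The number of facets of the convex hull of `a 0, …, a (m - 1)`. -/
noncomputable def numFacets {n m : ℕ} (a : Fin m → UnitSphere n) : ℝ≥0∞ :=
  ((facets (polytope a)).encard : ℝ≥0∞)

end RandomPolytope

/-!
The bound is a covering argument at the single scale `r` for which a cap of radius `r` is expected
to contain about `log m` of the points, that is `r ^ (n - 1) = A * log m / m`.

Let `C` be a maximal `r`-separated subset of the sphere. Suppose that each of the caps of radius
`r` around the points of `C` contains one of the random points, and let `u` be the unit outer
normal of a facet. Some random point is within `2 * r` of `u`, so the supporting hyperplane of the
facet is at least as far from the origin as that point in direction `u`. Hence every vertex of the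
facet is within `2 * r` of `u`, and all of them lie in one cap of radius `3 * r` around a point of
`C` (`facet_subset_cap_of_net`). The polytope is then also full-dimensional
(`finrank_vectorSpan_eq_of_net`), so a facet has `n` affinely independent vertices, which determine
it. The number of facets is thus at most the number of injective `n`-tuples of random points lying
in a common cap of radius `3 * r`. If some cap of radius `r` is empty, the trivial bound `m ^ n` is
used instead (`numFacets_le_sum`).

Taking expectations needs only that a cap of radius `ρ` has measure of order `ρ ^ (n - 1)`, which
follows by comparing a spherical shell over the cap with Euclidean balls
(`uniformSphere_closedBall_le`, `le_uniformSphere_closedBall`). In particular `C` has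
`O(r ^ (1 - n))` points (`exists_finset_net`). The tuples contribute
`O(m ^ n * r ^ (1 - n) * r ^ ((n - 1) * n)) = O((log m) ^ (n - 1) * m)`, and for a suitable `A` the
probability of an empty cap is so small that its contribution is `O(m)`.

Measurability holds without exceptional null set. The number of facets is the number of index sets
`J` for which the points indexed by `J` are exactly those on some supporting hyperplane and span a
space of the right dimension. The first condition is a countable union of projections of compact
sets, and the second is governed by the dimension of a span, which is lower semicontinuous.
-/

namespace RandomPolytope

/-! ### Facets and tuples of vertices -/

/-- A face of a polytope is the convex hull of the generating points that it contains. -/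
theorem convexHull_eq_of_isExposed {E : Type*} [NormedAddCommGroup E] [NormedSpace ℝ E]
    {ι : Type*} [Finite ι] (p : ι → E) {F : Set E}
    (hF : IsExposed ℝ (convexHull ℝ (Set.range p)) F) :
    convexHull ℝ (p '' {i | p i ∈ F}) = F := by
  have hPc : IsCompact (convexHull ℝ (Set.range p)) :=
    (Set.finite_range p).isCompact_convexHull ℝ
  have hFc : IsCompact F := hF.isCompact hPc
  have hconv : Convex ℝ F := hF.convex (convex_convexHull ℝ _)
  refine subset_antisymm (convexHull_min ?_ hconv) ?_
  · rintro _ ⟨i, hi, rfl⟩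
    exact hi
  · have hext : F.extremePoints ℝ ⊆ p '' {i | p i ∈ F} := by
      intro x hx
      obtain ⟨i, rfl⟩ :=
        extremePoints_convexHull_subset (hF.isExtreme.extremePoints_subset_extremePoints hx)
      exact ⟨i, hx.1, rfl⟩
    calc F = closure (convexHull ℝ (F.extremePoints ℝ)) :=
          (closure_convexHull_extremePoints hFc hconv).symm
      _ ⊆ closure (convexHull ℝ (p '' {i | p i ∈ F})) := closure_mono (convexHull_mono hext)
      _ = _ := ((((Set.toFinite {i | p i ∈ F}).image p).isCompact_convexHull ℝ).isClosed).closure_eq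

theorem vectorSpan_convexHull {E : Type*} [AddCommGroup E] [Module ℝ E] (s : Set E) :
    vectorSpan ℝ (convexHull ℝ s) = vectorSpan ℝ s := by
  rw [← direction_affineSpan, affineSpan_convexHull, direction_affineSpan]

theorem eq_inter_affineSpan_of_isExposed {E : Type*} [NormedAddCommGroup E] [NormedSpace ℝ E]
    {P F : Set E} (hF : IsExposed ℝ P F) (hne : F.Nonempty) :
    F = P ∩ affineSpan ℝ F := by
  obtain ⟨l, hl⟩ := hF hne
  refine subset_antisymm (fun x hx => ⟨hF.subset hx, subset_affineSpan ℝ F hx⟩) ?_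
  rintro x ⟨hxP, hxF⟩
  obtain ⟨y, hy⟩ := hne
  have hlF : ∀ z ∈ F, l z = l y := fun z hz => by
    rw [hl] at hz hy
    exact le_antisymm (hy.2 z hz.1) (hz.2 y hy.1)
  have hlx : l x = l y := by
    have hle : affineSpan ℝ F ≤ (AffineSubspace.mk' y (LinearMap.ker (l : E →ₗ[ℝ] ℝ))) := by
      rw [affineSpan_le]
      intro z hz
      simp [AffineSubspace.mem_mk', hlF z hz]
    have := hle hxF
    simpa [AffineSubspace.mem_mk', sub_eq_zero] using this
  rw [hl] at hy ⊢
  exact ⟨hxP, fun z hz => hlx ▸ hy.2 z hz⟩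

/-- A facet contains `n` of the generating points, possibly with repetitions, that have the same
affine span as the facet. Repetitions are needed only when the polytope is not full-dimensional. -/
theorem exists_tuple_of_mem_facets {n : ℕ} {ι : Type*} [Finite ι]
    (p : ι → EuclideanSpace ℝ (Fin n)) {F : Set (EuclideanSpace ℝ (Fin n))}
    (hF : F ∈ facets (convexHull ℝ (Set.range p))) :
    ∃ t : Fin n → ι, (∀ j, p (t j) ∈ F) ∧ affineSpan ℝ (Set.range (p ∘ t)) = affineSpan ℝ F ∧
      (Module.finrank ℝ (vectorSpan ℝ (Set.range p)) = n → Function.Injective t) := by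
  obtain ⟨hne, hexp, hdim⟩ := hF
  rw [vectorSpan_convexHull] at hdim
  have hspan : affineSpan ℝ (p '' {i | p i ∈ F}) = affineSpan ℝ F := by
    rw [← affineSpan_convexHull, convexHull_eq_of_isExposed p hexp]
  obtain ⟨T, hTsub, hTspan, hTind⟩ :=
    exists_affineIndependent ℝ (EuclideanSpace ℝ (Fin n)) (p '' {i | p i ∈ F})
  have hTfin : T.Finite := ((Set.toFinite {i | p i ∈ F}).image p).subset hTsub
  have hTne : T.Nonempty := by
    rw [← affineSpan_nonempty (k := ℝ), hTspan, hspan, affineSpan_nonempty]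
    exact hne
  have : Fintype T := hTfin.fintype
  have : Nonempty T := hTne.to_subtype
  have hcard : Fintype.card T = Module.finrank ℝ (vectorSpan ℝ (Set.range p)) := by
    rw [← hdim, ← direction_affineSpan ℝ F, ← hspan, ← hTspan, direction_affineSpan]
    have := hTind.finrank_vectorSpan_add_one
    rwa [Subtype.range_coe, eq_comm] at this
  have hle : Fintype.card T ≤ Fintype.card (Fin n) := by
    rw [hcard, Fintype.card_fin]
    exact (Submodule.finrank_le _).trans (by simp)
  obtain ⟨e⟩ := Function.Embedding.nonempty_of_card_le hle
  have hg := Function.invFun_surjective e.injective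
  set g : Fin n → T := Function.invFun e with hgdef
  choose t htF htp using fun j => hTsub (g j).2
  refine ⟨t, htF, ?_, fun h => ?_⟩
  · have : Set.range (p ∘ t) = T := by
      ext x
      simp only [Set.mem_range, Function.comp_apply, htp]
      exact ⟨fun ⟨j, hj⟩ => hj ▸ (g j).2, fun hx => (hg ⟨x, hx⟩).imp fun j hj => by rw [hj]⟩
    rw [this, hTspan, hspan]
  · have hb : Function.Bijective g :=
      (Fintype.bijective_iff_surjective_and_card g).2 ⟨hg, by rw [hcard, h, Fintype.card_fin]⟩
    intro i j hij
    apply hb.1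
    apply Subtype.ext
    rw [← htp, ← htp, hij]

/-- The number of facets is at most the number of those `n`-tuples of generating points that
satisfy any property `Q` shared by all tuples that lie in a facet and, if the polytope is
full-dimensional, have no repetitions: a facet is recovered from its affine span. -/
theorem encard_facets_le {n : ℕ} {ι : Type*} [Fintype ι]
    (p : ι → EuclideanSpace ℝ (Fin n)) (Q : (Fin n → ι) → Prop) [DecidablePred Q]
    (hQ : ∀ F ∈ facets (convexHull ℝ (Set.range p)), ∀ t : Fin n → ι, (∀ j, p (t j) ∈ F) →
      (Module.finrank ℝ (vectorSpan ℝ (Set.range p)) = n → Function.Injective t) → Q t) :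
    (facets (convexHull ℝ (Set.range p))).encard ≤ (Finset.univ.filter Q).card := by
  have h := fun F : facets (convexHull ℝ (Set.range p)) => exists_tuple_of_mem_facets p F.2
  choose t htF hspan hinj using h
  have hfin : ((Finset.univ.filter Q : Finset (Fin n → ι)) : Set (Fin n → ι)).encard =
      (Finset.univ.filter Q).card := Set.encard_coe_eq_coe_finsetCard _
  rw [← hfin, ← ENat.card_coe_set_eq, ← Set.encard_univ]
  refine Set.encard_le_encard_of_injOn (f := t) (fun F _ => ?_) (fun F _ G _ hFG => ?_)
  · simpa using hQ F F.2 (t F) (htF F) (hinj F)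
  · apply Subtype.ext
    rw [eq_inter_affineSpan_of_isExposed F.2.2.1 F.2.1,
      eq_inter_affineSpan_of_isExposed G.2.2.1 G.2.1, ← hspan F, ← hspan G, hFG]

/-! ### Facets when all caps of a net are occupied -/

theorem one_sub_le_inner {E : Type*} [NormedAddCommGroup E] [InnerProductSpace ℝ E] {u x : E}
    (hu : ‖u‖ = 1) (hx : ‖x‖ = 1) {ρ : ℝ} (h : dist x u ≤ ρ) : 1 - ρ ^ 2 / 2 ≤ inner ℝ u x := by
  have h1 : ‖x - u‖ ^ 2 ≤ ρ ^ 2 := by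
    rw [← dist_eq_norm]; exact pow_le_pow_left₀ dist_nonneg h 2
  rw [norm_sub_sq_real, hu, hx, real_inner_comm] at h1
  linarith

theorem dist_le_of_one_sub_le_inner {E : Type*} [NormedAddCommGroup E] [InnerProductSpace ℝ E]
    {u x : E} (hu : ‖u‖ = 1) (hx : ‖x‖ = 1) {ρ : ℝ} (hρ : 0 ≤ ρ)
    (h : 1 - ρ ^ 2 / 2 ≤ inner ℝ u x) : dist x u ≤ ρ := by
  rw [dist_eq_norm]
  refine abs_le_of_sq_le_sq' ?_ hρ |>.2
  rw [norm_sub_sq_real, hu, hx, real_inner_comm]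
  linarith

section Net

variable {n : ℕ} {ι : Type*} (a : ι → UnitSphere n) {C : Set (UnitSphere n)} {r : ℝ}

/-- If every cap of radius `r` around a point of the net `C` contains one of the points `a i`, then
in every direction `u` the polytope reaches height at least `1 - 2 * r ^ 2`. -/
theorem exists_one_sub_le_inner (hcov : ∀ x, ∃ c ∈ C, dist x c ≤ r)
    (ha : ∀ c ∈ C, ∃ i, dist (a i) c ≤ r) (u : UnitSphere n) :
    ∃ c ∈ C, dist u c ≤ r ∧
      ∃ i, 1 - (2 * r) ^ 2 / 2 ≤ inner ℝ (u : EuclideanSpace ℝ (Fin n)) (a i) := by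
  obtain ⟨c, hc, huc⟩ := hcov u
  obtain ⟨i, hi⟩ := ha c hc
  refine ⟨c, hc, huc, i, one_sub_le_inner (by simp) (by simp) ?_⟩
  have := dist_triangle_right (a i) u c
  rw [← Subtype.dist_eq]
  linarith

/-- If the points `a i` meet every cap of radius `r ≤ 1 / 2` around a point of the net, they do not
lie in a hyperplane: `inner ℝ u` and `inner ℝ (-u)` both take positive values on them, so
`inner ℝ u` is not constant on them for any unit vector `u`. -/
theorem finrank_vectorSpan_eq_of_net (hr : 0 ≤ r) (hr' : r ≤ 1 / 2)
    (hcov : ∀ x, ∃ c ∈ C, dist x c ≤ r) (ha : ∀ c ∈ C, ∃ i, dist (a i) c ≤ r) :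
    Module.finrank ℝ (vectorSpan ℝ (Set.range fun i => (a i : EuclideanSpace ℝ (Fin n)))) = n := by
  set K := vectorSpan ℝ (Set.range fun i => (a i : EuclideanSpace ℝ (Fin n))) with hK
  suffices K = ⊤ by rw [this, finrank_top, finrank_euclideanSpace_fin]
  by_contra hne
  rw [← Submodule.orthogonal_eq_bot_iff] at hne
  obtain ⟨v, hvK, hv⟩ := Submodule.exists_mem_ne_zero_of_ne_bot hne
  have hnv : ‖v‖ ≠ 0 := norm_ne_zero_iff.2 hv
  set u : UnitSphere n := ⟨‖v‖⁻¹ • v, by simp [norm_smul, hnv]⟩ with hu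
  have huK : (u : EuclideanSpace ℝ (Fin n)) ∈ Kᗮ := Kᗮ.smul_mem _ hvK
  obtain ⟨-, -, -, i, hi⟩ := exists_one_sub_le_inner a hcov ha u
  obtain ⟨-, -, -, j, hj⟩ := exists_one_sub_le_inner a hcov ha (-u)
  have h0 : inner ℝ (u : EuclideanSpace ℝ (Fin n)) ((a i : EuclideanSpace ℝ (Fin n)) - a j) = 0 :=
    Submodule.inner_left_of_mem_orthogonal
      (vsub_mem_vectorSpan ℝ (Set.mem_range_self i) (Set.mem_range_self j)) huK
  rw [inner_sub_right] at h0
  rw [coe_neg_sphere, inner_neg_left] at hj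
  nlinarith

/-- If the points `a i` meet every cap of radius `r` around a point of the net, then all points of a
facet lie in one cap of radius `3 * r` around a point of the net. The centre of that cap is a point
of the net near the unit outer normal of the facet. -/
theorem facet_subset_cap_of_net [Finite ι] (hr : 0 ≤ r)
    (hcov : ∀ x, ∃ c ∈ C, dist x c ≤ r) (ha : ∀ c ∈ C, ∃ i, dist (a i) c ≤ r)
    {F : Set (EuclideanSpace ℝ (Fin n))}
    (hF : F ∈ facets (convexHull ℝ (Set.range fun i => (a i : EuclideanSpace ℝ (Fin n))))) :
    ∃ c ∈ C, ∀ i, (a i : EuclideanSpace ℝ (Fin n)) ∈ F → dist (a i) c ≤ 3 * r := by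
  obtain ⟨hne, hexp, hdim⟩ := hF
  obtain ⟨l, hl⟩ := hexp hne
  set v := (InnerProductSpace.toDual ℝ (EuclideanSpace ℝ (Fin n))).symm l with hvdef
  have hlv : ∀ x, l x = inner ℝ v x := fun x => by
    rw [hvdef, InnerProductSpace.toDual_symm_apply]
  -- For `v = 0` the exposed face would be the whole polytope, which has the wrong dimension.
  have hv : v ≠ 0 := by
    intro hv
    have : F = convexHull ℝ (Set.range fun i => (a i : EuclideanSpace ℝ (Fin n))) := by
      rw [hl]; ext x; simp [hlv, hv]
    rw [← this] at hdim
    omega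
  have hnv : 0 < ‖v‖ := norm_pos_iff.2 hv
  set u : UnitSphere n := ⟨‖v‖⁻¹ • v, by simp [norm_smul, hnv.ne']⟩ with hu
  obtain ⟨c, hc, huc, i, hi⟩ := exists_one_sub_le_inner a hcov ha u
  refine ⟨c, hc, fun j hj => ?_⟩
  have hij : inner ℝ (u : EuclideanSpace ℝ (Fin n)) (a i) ≤
      inner ℝ (u : EuclideanSpace ℝ (Fin n)) (a j) := by
    rw [hl] at hj
    have := hj.2 _ (subset_convexHull ℝ _ (Set.mem_range_self i))
    rw [hlv, hlv] at this
    simp only [hu, real_inner_smul_left]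
    gcongr
  have := dist_le_of_one_sub_le_inner (u := (u : EuclideanSpace ℝ (Fin n)))
    (x := a j) (by simp) (by simp) (by positivity) (hi.trans hij)
  rw [← Subtype.dist_eq] at this
  have := dist_triangle (a j) u c
  linarith

end Net

/-! ### Nets -/

/-- If all balls of radius `r / 2` have measure at least `q`, there is an `r`-net with at most
`1 / q` points: a maximal `r`-separated set, the balls of radius `r / 2` around its points being
disjoint. -/
theorem exists_finset_net {X : Type*} [MetricSpace X] [MeasurableSpace X] [BorelSpace X]
    (μ : Measure X) [IsProbabilityMeasure μ] {r q : ℝ} (hr : 0 < r) (hq : 0 < q)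
    (hball : ∀ x, q ≤ μ.real (Metric.closedBall x (r / 2))) :
    ∃ C : Finset X, (∀ x, ∃ c ∈ C, dist x c ≤ r) ∧ (C.card : ℝ) * q ≤ 1 := by
  have key : ∀ C : Set X, Metric.IsSeparated (r.toNNReal : ℝ≥0∞) C →
      ∃ D : Finset X, (D : Set X) = C ∧ (D.card : ℝ) * q ≤ 1 := by
    intro C hC
    have hdisj : Pairwise (Function.onFun Disjoint
        fun c : C => Metric.closedBall (c : X) (r / 2)) := by
      intro c d hcd
      apply Metric.closedBall_disjoint_closedBall
      have h := hC c.2 d.2 (fun h => hcd (Subtype.ext h))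
      change ENNReal.ofReal r < edist (c : X) d at h
      rw [edist_dist, ENNReal.ofReal_lt_ofReal_iff_of_nonneg hr.le] at h
      linarith
    have hfin : C.Finite := by
      have h := Measure.finite_const_le_meas_of_disjoint_iUnion μ (ENNReal.ofReal_pos.2 hq)
        (fun c : C => Metric.isClosed_closedBall.measurableSet) hdisj (measure_ne_top _ _)
      have huniv : {c : C | ENNReal.ofReal q ≤ μ (Metric.closedBall (c : X) (r / 2))} =
          Set.univ := by
        ext c
        simpa using ENNReal.ofReal_le_of_le_toReal (hball c)
      rw [huniv] at h
      exact Set.finite_coe_iff.1 (Set.finite_univ_iff.1 h)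
    refine ⟨hfin.toFinset, hfin.coe_toFinset, ?_⟩
    calc (hfin.toFinset.card : ℝ) * q = ∑ _c ∈ hfin.toFinset, q := by simp
      _ ≤ ∑ c ∈ hfin.toFinset, μ.real (Metric.closedBall c (r / 2)) :=
          Finset.sum_le_sum fun c _ => hball c
      _ = μ.real (⋃ c ∈ hfin.toFinset, Metric.closedBall c (r / 2)) := by
          rw [measureReal_biUnion_finset]
          · intro c hc d hd hcd
            exact hdisj (i := ⟨c, by simpa using hc⟩) (j := ⟨d, by simpa using hd⟩)
              (by simpa using hcd)
          · exact fun c _ => Metric.isClosed_closedBall.measurableSet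
      _ ≤ 1 := measureReal_le_one
  have htop : Metric.packingNumber r.toNNReal (Set.univ : Set X) ≠ ⊤ := by
    have : Metric.packingNumber r.toNNReal (Set.univ : Set X) ≤ (⌊q⁻¹⌋₊ : ℕ∞) := by
      refine iSup₂_le fun C _ => iSup_le fun hC => ?_
      obtain ⟨D, rfl, hD⟩ := key C hC
      rw [Set.encard_coe_eq_coe_finsetCard, Nat.cast_le]
      exact Nat.le_floor ((le_div_iff₀ hq).2 hD |>.trans_eq (one_div q))
    exact ne_top_of_le_ne_top (ENat.natCast_ne_top _) this
  obtain ⟨D, hDC, hD⟩ := key _ (Metric.isSeparated_maximalSeparatedSet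
    (ε := r.toNNReal) (A := (Set.univ : Set X)))
  refine ⟨D, fun x => ?_, hD⟩
  obtain ⟨c, hc, hxc⟩ := Metric.isCover_maximalSeparatedSet htop (Set.mem_univ x)
  refine ⟨c, by rwa [← Finset.mem_coe, hDC], ?_⟩
  have : edist x c ≤ ENNReal.ofReal r := hxc
  rwa [edist_dist, ENNReal.ofReal_le_ofReal_iff hr.le] at this

/-! ### The measure of spherical caps -/

section Caps

open scoped Pointwise

variable {n : ℕ}

/-- The set of all `t • y` with `0 < t < 1` and `y ∈ s`: the part of the open unit ball, without
its centre, that lies over the set `s` of directions. -/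
def cone (s : Set (UnitSphere n)) : Set (EuclideanSpace ℝ (Fin n)) :=
  Set.Ioo (0 : ℝ) 1 • (Subtype.val '' s)

theorem mem_cone {s : Set (UnitSphere n)} {x : EuclideanSpace ℝ (Fin n)} :
    x ∈ cone s ↔ ∃ t : ℝ, 0 < t ∧ t < 1 ∧ ∃ y ∈ s, t • (y : EuclideanSpace ℝ (Fin n)) = x := by
  simp only [cone, Set.mem_smul, Set.mem_Ioo, Set.exists_mem_image, and_assoc]

theorem cone_subset_ball (s : Set (UnitSphere n)) : cone s ⊆ Metric.ball 0 1 := by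
  intro x hx
  obtain ⟨t, h0, h1, y, -, rfl⟩ := mem_cone.1 hx
  simpa [norm_smul, abs_of_pos h0] using h1

theorem measure_cone_ne_top (s : Set (UnitSphere n)) : volume (cone s) ≠ ⊤ :=
  ne_top_of_le_ne_top measure_ball_lt_top.ne (measure_mono (cone_subset_ball s))

theorem volume_real_unitBall_pos (n : ℕ) :
    0 < volume.real (Metric.ball (0 : EuclideanSpace ℝ (Fin n)) 1) :=
  ENNReal.toReal_pos (Metric.measure_ball_pos _ _ one_pos).ne' measure_ball_lt_top.ne

/-- The uniform measure of `s` is the share of the unit ball that lies over `s`. -/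
theorem uniformSphere_real_mul (hn : 1 ≤ n) {s : Set (UnitSphere n)} (hs : MeasurableSet s) :
    (uniformSphere n).real s * volume.real (Metric.ball (0 : EuclideanSpace ℝ (Fin n)) 1) =
      volume.real (cone s) := by
  have hb : 0 < volume.real (Metric.ball (0 : EuclideanSpace ℝ (Fin n)) 1) :=
    volume_real_unitBall_pos n
  have hn' : (n : ℝ) ≠ 0 := by positivity
  simp only [uniformSphere, measureReal_def, Measure.smul_apply, smul_eq_mul,
    Measure.toSphere_apply_univ, Measure.toSphere_apply' _ hs, ENNReal.toReal_mul,
    ENNReal.toReal_inv, finrank_euclideanSpace_fin, ENNReal.toReal_natCast] at hb ⊢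
  rw [cone]
  field_simp

theorem volume_real_smul_cone (s : Set (UnitSphere n)) {q : ℝ} (hq : 0 ≤ q) :
    volume.real (q • cone s) = q ^ n * volume.real (cone s) := by
  rw [measureReal_def, Measure.addHaar_smul, finrank_euclideanSpace_fin, ENNReal.toReal_mul,
    ENNReal.toReal_ofReal (abs_nonneg _), abs_of_nonneg (by positivity), measureReal_def]

/-- Upper bound for the measure of a cap of radius `ρ`: the shell of width `r` over the cap is
contained in a Euclidean ball of radius `r + ρ`. -/
theorem uniformSphere_closedBall_le (hn : 1 ≤ n) (c : UnitSphere n) {r ρ : ℝ} (hr : 0 < r)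
    (hr1 : r < 1) (hρ : 0 ≤ ρ) :
    r * (uniformSphere n).real (Metric.closedBall c ρ) ≤ (r + ρ) ^ n := by
  have : Nonempty (Fin n) := ⟨⟨0, hn⟩⟩
  set ω := volume.real (Metric.ball (0 : EuclideanSpace ℝ (Fin n)) 1) with hω
  have hb : 0 < ω :=
    volume_real_unitBall_pos n
  set s := Metric.closedBall c ρ
  have hmul := uniformSphere_real_mul hn (s := s) Metric.isClosed_closedBall.measurableSet
  -- The shell over the cap is the complement in the cone of its homothetic copy of ratio `1 - r`.
  have hsub : cone s ⊆ (1 - r) • cone s ∪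
      Metric.closedBall (c : EuclideanSpace ℝ (Fin n)) (r + ρ) := by
    intro x hx
    obtain ⟨t, h0, h1, y, hy, rfl⟩ := mem_cone.1 hx
    rcases lt_or_ge t (1 - r) with ht | ht
    · left
      refine ⟨(t / (1 - r)) • (y : EuclideanSpace ℝ (Fin n)), mem_cone.2
        ⟨_, div_pos h0 (by linarith), (div_lt_one (by linarith)).2 ht, y, hy, rfl⟩, ?_⟩
      simp only [smul_smul]
      rw [mul_div_cancel₀ _ (by linarith)]
    · right
      have h2 : dist (t • (y : EuclideanSpace ℝ (Fin n))) y ≤ r := by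
        have : t • (y : EuclideanSpace ℝ (Fin n)) - y =
            (t - 1) • (y : EuclideanSpace ℝ (Fin n)) := by
          rw [sub_smul, one_smul]
        rw [dist_eq_norm, this, norm_smul, norm_eq_of_mem_sphere, mul_one, Real.norm_eq_abs,
          abs_le]
        constructor <;> linarith
      exact (dist_triangle _ _ _).trans (add_le_add h2 hy)
  have hle : volume.real (cone s) ≤ (1 - r) ^ n * volume.real (cone s) + (r + ρ) ^ n * ω := by
    calc volume.real (cone s) ≤ volume.real ((1 - r) • cone s ∪
          Metric.closedBall (c : EuclideanSpace ℝ (Fin n)) (r + ρ)) := by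
          refine measureReal_mono hsub (measure_union_ne_top ?_ measure_closedBall_lt_top.ne)
          rw [Measure.addHaar_smul]
          exact ENNReal.mul_ne_top ENNReal.ofReal_ne_top (measure_cone_ne_top _)
      _ ≤ _ := measureReal_union_le _ _
      _ = _ := by
          rw [volume_real_smul_cone s (by linarith), measureReal_def (s := Metric.closedBall _ _),
            Measure.addHaar_closedBall _ _ (by positivity), finrank_euclideanSpace_fin,
            ENNReal.toReal_mul, ENNReal.toReal_ofReal (by positivity)]
          rfl
  have hpow : (1 - r) ^ n ≤ 1 - r := pow_le_of_le_one (by linarith) (by linarith) (by omega)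
  rw [← hmul] at hle
  have h0 : 0 ≤ (uniformSphere n).real s := measureReal_nonneg
  refine le_of_mul_le_mul_right ?_ hb
  nlinarith [mul_le_mul_of_nonneg_right hpow (mul_nonneg h0 hb.le)]

/-- Lower bound for the measure of a cap of radius `2 * r`: the shell of width `r` over the cap
contains a Euclidean ball of radius `r / 4`. -/
theorem le_uniformSphere_closedBall (hn : 1 ≤ n) (c : UnitSphere n) {r : ℝ} (hr : 0 < r)
    (hr1 : r < 1) :
    (r / 4) ^ n ≤ n * r * (uniformSphere n).real (Metric.closedBall c (2 * r)) := by
  have : Nonempty (Fin n) := ⟨⟨0, hn⟩⟩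
  set ω := volume.real (Metric.ball (0 : EuclideanSpace ℝ (Fin n)) 1) with hω
  have hb : 0 < ω :=
    volume_real_unitBall_pos n
  set s := Metric.closedBall c (2 * r)
  have hmul := uniformSphere_real_mul hn (s := s) Metric.isClosed_closedBall.measurableSet
  -- A ball centred at mid-depth of the shell of width `r`.
  set B := Metric.ball ((1 - r / 2) • (c : EuclideanSpace ℝ (Fin n))) (r / 4) with hB
  have hnorm : ∀ x ∈ B, 1 - r < ‖x‖ ∧ ‖x‖ < 1 ∧ dist x c ≤ 3 / 4 * r := by
    intro x hx
    have h1 : ‖(1 - r / 2) • (c : EuclideanSpace ℝ (Fin n))‖ = 1 - r / 2 := by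
      rw [norm_smul, norm_eq_of_mem_sphere, mul_one, Real.norm_of_nonneg (by linarith)]
    have h2 : dist x ((1 - r / 2) • (c : EuclideanSpace ℝ (Fin n))) < r / 4 := hx
    have h3 : dist ((1 - r / 2) • (c : EuclideanSpace ℝ (Fin n))) c = r / 2 := by
      have : (1 - r / 2) • (c : EuclideanSpace ℝ (Fin n)) - c =
          (-(r / 2)) • (c : EuclideanSpace ℝ (Fin n)) := by module
      rw [dist_eq_norm, this, norm_smul, norm_eq_of_mem_sphere, mul_one, norm_neg,
        Real.norm_of_nonneg (by linarith)]
    have h4 := dist_triangle x ((1 - r / 2) • (c : EuclideanSpace ℝ (Fin n))) c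
    rw [dist_eq_norm] at h2
    have h5 := abs_le.1 (abs_norm_sub_norm_le x ((1 - r / 2) • (c : EuclideanSpace ℝ (Fin n))))
    rw [h1] at h5
    refine ⟨by linarith, by linarith, ?_⟩
    rw [h3, dist_eq_norm x (_ • _)] at h4
    linarith
  have hBcone : B ⊆ cone s := by
    intro x hx
    obtain ⟨hx1, hx2, hx3⟩ := hnorm x hx
    have hx0 : 0 < ‖x‖ := by linarith
    refine mem_cone.2 ⟨‖x‖, hx0, hx2, ⟨‖x‖⁻¹ • x, by simp [norm_smul, hx0.ne']⟩, ?_, ?_⟩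
    · have h1 : dist (‖x‖⁻¹ • x) x = 1 - ‖x‖ := by
        have : ‖x‖⁻¹ • x - x = (‖x‖⁻¹ - 1) • x := by module
        rw [dist_eq_norm, this, norm_smul, Real.norm_of_nonneg, sub_mul, one_mul,
          inv_mul_cancel₀ hx0.ne']
        rw [sub_nonneg]
        exact (one_le_inv₀ hx0).2 hx2.le
      have := dist_triangle (‖x‖⁻¹ • x) x c
      rw [Metric.mem_closedBall, Subtype.dist_eq]
      linarith
    · simp [smul_smul, hx0.ne']
  have hdisj : Disjoint ((1 - r) • cone s) B := by
    rw [Set.disjoint_left]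
    rintro _ ⟨y, hy, rfl⟩ hyB
    have h1 := (hnorm _ hyB).1
    have h2 : ‖y‖ < 1 := by simpa using cone_subset_ball s hy
    simp only [norm_smul, Real.norm_of_nonneg (show 0 ≤ 1 - r by linarith)] at h1
    nlinarith
  have hscale : (1 - r) • cone s ⊆ cone s := by
    rintro _ ⟨x, hx, rfl⟩
    obtain ⟨t, h0, h1, y, hy, rfl⟩ := mem_cone.1 hx
    exact mem_cone.2 ⟨(1 - r) * t, mul_pos (by linarith) h0, by nlinarith, y, hy,
      by simp [smul_smul]⟩
  have hle : (1 - r) ^ n * volume.real (cone s) + (r / 4) ^ n * ω ≤ volume.real (cone s) := by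
    calc _ = volume.real ((1 - r) • cone s) + volume.real B := by
          rw [volume_real_smul_cone s (by linarith), measureReal_def (s := B),
            Measure.addHaar_ball _ _ (by positivity), finrank_euclideanSpace_fin,
            ENNReal.toReal_mul, ENNReal.toReal_ofReal (by positivity)]
          rfl
      _ = volume.real ((1 - r) • cone s ∪ B) :=
          (measureReal_union hdisj measurableSet_ball
            (ne_top_of_le_ne_top (measure_cone_ne_top s) (measure_mono hscale))
            measure_ball_lt_top.ne).symm
      _ ≤ _ := measureReal_mono (Set.union_subset hscale hBcone) (measure_cone_ne_top s)
  have hpow : 1 - n * r ≤ (1 - r) ^ n := by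
    have := one_add_mul_le_pow (a := -r) (by linarith) n
    rw [← sub_eq_add_neg] at this
    linarith
  rw [← hmul] at hle
  have h0 : 0 ≤ (uniformSphere n).real s := measureReal_nonneg
  refine le_of_mul_le_mul_right ?_ hb
  nlinarith [mul_le_mul_of_nonneg_right hpow (mul_nonneg h0 hb.le)]

end Caps

/-! ### The expected number of facets at a given scale -/

/-- For independent `a i` with law `μ` and distinct indices `t j`, the events that `a (t j)` lies in
`B` are independent of probability `μ B`. -/
theorem pi_forall_mem_of_injective {X : Type*} [MeasurableSpace X] (μ : Measure X)
    [IsProbabilityMeasure μ] {ι κ : Type*} [Fintype ι] [Fintype κ] {t : κ → ι}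
    (ht : Function.Injective t) (B : Set X) :
    Measure.pi (fun _ : ι => μ) {a | ∀ j, a (t j) ∈ B} = μ B ^ Fintype.card κ := by
  classical
  have hset : {a : ι → X | ∀ j, a (t j) ∈ B} =
      Set.univ.pi fun i => if i ∈ Finset.univ.image t then B else Set.univ := by
    ext a
    simp only [Set.mem_ofPred_eq, Set.mem_univ_pi]
    refine ⟨fun h i => ?_, fun h j => by simpa using h (t j)⟩
    split_ifs with hi
    · obtain ⟨j, -, rfl⟩ := Finset.mem_image.1 hi
      exact h j
    · trivial
  rw [hset, Measure.pi_pi]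
  simp only [apply_ite μ, measure_univ]
  rw [Finset.prod_ite_mem, Finset.univ_inter, Finset.prod_const,
    Finset.card_image_of_injective _ ht, Finset.card_univ]

theorem measurableSet_forall_mem {κ X : Type*} [MeasurableSpace X] [Countable κ] {ι : Type*}
    (t : κ → ι) {B : Set X} (hB : MeasurableSet B) :
    MeasurableSet {a : ι → X | ∀ j, a (t j) ∈ B} := by
  rw [Set.ofPred_forall]
  exact MeasurableSet.iInter fun j => measurable_pi_apply (t j) hB

section Expectation

variable {n m : ℕ} {C : Finset (UnitSphere n)} {r : ℝ}

theorem numFacets_le_card_pow (a : Fin m → UnitSphere n) : numFacets a ≤ (m : ℝ≥0∞) ^ n := by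
  have h := encard_facets_le (fun i => (a i : EuclideanSpace ℝ (Fin n))) (fun _ => True)
    (fun _ _ _ _ _ => trivial)
  have h' : (facets (polytope a)).encard ≤ ((m ^ n : ℕ) : ℕ∞) := by
    simpa [polytope] using h
  calc numFacets a ≤ (((m ^ n : ℕ) : ℕ∞) : ℝ≥0∞) := ENat.toENNReal_le.2 h'
    _ = _ := by simp

open Classical in
/-- The number of facets is at most the number of pairs of an injective `n`-tuple of the points and
a cap of radius `3 * r` around a point of the net that contains it, plus `m ^ n` times the number of
caps of radius `r` around points of the net that contain none of the points. -/
theorem numFacets_le_sum (hr : 0 ≤ r) (hr' : r ≤ 1 / 2) (hcov : ∀ x, ∃ c ∈ C, dist x c ≤ r)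
    (a : Fin m → UnitSphere n) :
    numFacets a ≤
      ∑ t : Fin n → Fin m with Function.Injective t, ∑ c ∈ C,
        {b : Fin m → UnitSphere n | ∀ j, b (t j) ∈ Metric.closedBall c (3 * r)}.indicator 1 a +
      (m : ℝ≥0∞) ^ n * ∑ c ∈ C,
        {b : Fin m → UnitSphere n | ∀ i, b i ∈ (Metric.closedBall c r)ᶜ}.indicator 1 a := by
  by_cases hbad : ∃ c ∈ C, ∀ i, a i ∈ (Metric.closedBall c r)ᶜ
  · obtain ⟨c, hc, hac⟩ := hbad
    refine (numFacets_le_card_pow a).trans (le_add_left ?_)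
    have h1 : (1 : ℝ≥0∞) ≤ ∑ c ∈ C,
        {b : Fin m → UnitSphere n | ∀ i, b i ∈ (Metric.closedBall c r)ᶜ}.indicator 1 a := by
      refine le_trans ?_ (Finset.single_le_sum (fun _ _ => zero_le) hc)
      rw [Set.indicator_of_mem (by exact hac)]
      simp
    simpa using mul_le_mul_right h1 ((m : ℝ≥0∞) ^ n)
  · have ha : ∀ c ∈ (C : Set (UnitSphere n)), ∃ i, dist (a i) c ≤ r := by
      simpa using hbad
    refine le_add_right ?_
    have h := encard_facets_le (fun i => (a i : EuclideanSpace ℝ (Fin n)))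
      (fun t : Fin n → Fin m => Function.Injective t ∧
        ∃ c ∈ C, ∀ j, a (t j) ∈ Metric.closedBall c (3 * r))
      (fun F hF t ht hinj => by
        obtain ⟨c, hc, hFc⟩ := facet_subset_cap_of_net a hr hcov ha hF
        exact ⟨hinj (finrank_vectorSpan_eq_of_net a hr hr' hcov ha), c, hc,
          fun j => hFc _ (ht j)⟩)
    calc numFacets a ≤ (((Finset.univ.filter (fun t : Fin n → Fin m => Function.Injective t ∧
        ∃ c ∈ C, ∀ j, a (t j) ∈ Metric.closedBall c (3 * r))).card : ℕ∞) : ℝ≥0∞) :=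
          ENat.toENNReal_le.2 h
      _ = ∑ t : Fin n → Fin m with Function.Injective t,
          if ∃ c ∈ C, ∀ j, a (t j) ∈ Metric.closedBall c (3 * r) then 1 else 0 := by
          rw [← Finset.filter_filter, Finset.sum_boole]
          simp
      _ ≤ _ := by
          refine Finset.sum_le_sum fun t _ => ?_
          split_ifs with ht
          · obtain ⟨c, hc, hct⟩ := ht
            refine le_trans ?_ (Finset.single_le_sum (fun _ _ => zero_le) hc)
            rw [Set.indicator_of_mem (by exact hct)]
            simp
          · exact zero_le

theorem lintegral_numFacets_le (hn : 1 ≤ n) (hr : 0 ≤ r) (hr' : r ≤ 1 / 2)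
    (hcov : ∀ x, ∃ c ∈ C, dist x c ≤ r) {p q : ℝ} (hp : 0 ≤ p)
    (hle : ∀ c, (uniformSphere n).real (Metric.closedBall c (3 * r)) ≤ p)
    (hge : ∀ c, q ≤ (uniformSphere n).real (Metric.closedBall c r)) (hq : q ≤ 1) :
    ∫⁻ a : Fin m → UnitSphere n, numFacets a ∂(randomPoints n m) ≤
      ENNReal.ofReal ((m : ℝ) ^ n * (C.card * (p ^ n + (1 - q) ^ m))) := by
  classical
  have : IsProbabilityMeasure (uniformSphere n) := isProbabilityMeasure_uniformSphere n hn
  have hA : ∀ (t : Fin n → Fin m) (c : UnitSphere n), MeasurableSet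
      {b : Fin m → UnitSphere n | ∀ j, b (t j) ∈ Metric.closedBall c (3 * r)} :=
    fun t c => measurableSet_forall_mem t Metric.isClosed_closedBall.measurableSet
  have hB : ∀ c : UnitSphere n, MeasurableSet
      {b : Fin m → UnitSphere n | ∀ i, b i ∈ (Metric.closedBall c r)ᶜ} :=
    fun c => measurableSet_forall_mem id Metric.isClosed_closedBall.measurableSet.compl
  have hAle : ∀ (t : Fin n → Fin m), Function.Injective t → ∀ c : UnitSphere n,
      randomPoints n m {b | ∀ j, b (t j) ∈ Metric.closedBall c (3 * r)} ≤
        ENNReal.ofReal (p ^ n) := by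
    intro t ht c
    rw [randomPoints, pi_forall_mem_of_injective _ ht, Fintype.card_fin, ENNReal.ofReal_pow hp]
    gcongr
    rw [← ofReal_measureReal]
    exact ENNReal.ofReal_le_ofReal (hle c)
  have hBle : ∀ c : UnitSphere n,
      randomPoints n m {b | ∀ i, b i ∈ (Metric.closedBall c r)ᶜ} ≤
        ENNReal.ofReal ((1 - q) ^ m) := by
    intro c
    have h := pi_forall_mem_of_injective (uniformSphere n) (ι := Fin m)
      Function.injective_id (Metric.closedBall c r)ᶜ
    simp only [id] at h
    rw [randomPoints, h, Fintype.card_fin, ENNReal.ofReal_pow (by linarith)]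
    gcongr
    rw [← ofReal_measureReal, probReal_compl_eq_one_sub Metric.isClosed_closedBall.measurableSet]
    exact ENNReal.ofReal_le_ofReal (by linarith [hge c])
  have hcard : ((Finset.univ.filter fun t : Fin n → Fin m => Function.Injective t).card : ℝ≥0∞) ≤
      (m : ℝ≥0∞) ^ n := by
    have := Finset.card_filter_le (Finset.univ : Finset (Fin n → Fin m)) Function.Injective
    rw [Finset.card_univ, Fintype.card_fun, Fintype.card_fin, Fintype.card_fin] at this
    exact_mod_cast this
  calc ∫⁻ a : Fin m → UnitSphere n, numFacets a ∂(randomPoints n m)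
      ≤ ∫⁻ a : Fin m → UnitSphere n, (∑ t : Fin n → Fin m with Function.Injective t, ∑ c ∈ C,
          {b : Fin m → UnitSphere n | ∀ j, b (t j) ∈ Metric.closedBall c (3 * r)}.indicator 1 a +
        (m : ℝ≥0∞) ^ n * ∑ c ∈ C,
          {b : Fin m → UnitSphere n | ∀ i, b i ∈ (Metric.closedBall c r)ᶜ}.indicator 1 a)
          ∂(randomPoints n m) := lintegral_mono fun a => numFacets_le_sum hr hr' hcov a
    _ = ∑ t : Fin n → Fin m with Function.Injective t, ∑ c ∈ C,
          randomPoints n m {b | ∀ j, b (t j) ∈ Metric.closedBall c (3 * r)} +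
        (m : ℝ≥0∞) ^ n * ∑ c ∈ C,
          randomPoints n m {b | ∀ i, b i ∈ (Metric.closedBall c r)ᶜ} := by
        have hmA : ∀ (t : Fin n → Fin m) c, Measurable ({b : Fin m → UnitSphere n |
            ∀ j, b (t j) ∈ Metric.closedBall c (3 * r)}.indicator
              (1 : (Fin m → UnitSphere n) → ℝ≥0∞)) :=
          fun t c => measurable_one.indicator (hA t c)
        have hmB : ∀ c, Measurable ({b : Fin m → UnitSphere n |
            ∀ i, b i ∈ (Metric.closedBall c r)ᶜ}.indicator (1 : (Fin m → UnitSphere n) → ℝ≥0∞)) :=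
          fun c => measurable_one.indicator (hB c)
        rw [lintegral_add_right _ ((Finset.measurable_fun_sum _ fun c _ => hmB c).const_mul _),
          lintegral_const_mul _ (Finset.measurable_fun_sum _ fun c _ => hmB c),
          lintegral_finsetSum _ fun c _ => hmB c,
          lintegral_finsetSum _ fun t _ => Finset.measurable_fun_sum _ fun c _ => hmA t c]
        simp_rw [lintegral_finsetSum _ fun c _ => hmA _ c, lintegral_indicator_one (hA _ _),
          lintegral_indicator_one (hB _)]
    _ ≤ ∑ t : Fin n → Fin m with Function.Injective t, ∑ c ∈ C, ENNReal.ofReal (p ^ n) +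
        (m : ℝ≥0∞) ^ n * ∑ c ∈ C, ENNReal.ofReal ((1 - q) ^ m) := by
        gcongr with t ht c hc c hc
        · exact hAle t (Finset.mem_filter.1 ht).2 c
        · exact hBle c
    _ ≤ (m : ℝ≥0∞) ^ n * (C.card * ENNReal.ofReal (p ^ n)) +
        (m : ℝ≥0∞) ^ n * (C.card * ENNReal.ofReal ((1 - q) ^ m)) := by
        simp only [Finset.sum_const, nsmul_eq_mul]
        gcongr
    _ = _ := by
        have h1 : 0 ≤ p ^ n := by positivity
        have h2 : 0 ≤ (1 - q) ^ m := pow_nonneg (by linarith) _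
        rw [← mul_add, ← mul_add, ← ENNReal.ofReal_add h1 h2, ENNReal.ofReal_mul (by positivity),
          ENNReal.ofReal_mul (by positivity), ENNReal.ofReal_pow (by positivity),
          ENNReal.ofReal_natCast, ENNReal.ofReal_natCast]

end Expectation

/-- Caps of radius `r` have measure of order `r ^ (n - 1)`, uniformly in the centre; the two radii
are those of the packing balls and of the caps that contain the facets. -/
theorem exists_cap_bounds (n : ℕ) (hn : 2 ≤ n) :
    ∃ α β : ℝ, 0 < α ∧ 0 < β ∧ ∀ r : ℝ, 0 < r → r < 1 → ∀ c : UnitSphere n,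
      α * r ^ (n - 1) ≤ (uniformSphere n).real (Metric.closedBall c (r / 2)) ∧
      (uniformSphere n).real (Metric.closedBall c (3 * r)) ≤ β * r ^ (n - 1) := by
  obtain ⟨d, rfl⟩ : ∃ d, n = d + 1 := ⟨n - 1, by omega⟩
  refine ⟨(1 / 16) ^ (d + 1) / ((d + 1 : ℕ) * (1 / 4)), 4 ^ (d + 1), by positivity, by positivity,
    fun r hr hr1 c => ⟨?_, ?_⟩⟩
  · have h := le_uniformSphere_closedBall (by omega) c (r := r / 4) (by linarith) (by linarith)
    rw [show 2 * (r / 4) = r / 2 by ring, show r / 4 / 4 = (1 / 16) * r by ring, mul_pow,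
      pow_succ r] at h
    rw [Nat.add_sub_cancel, div_mul_eq_mul_div, div_le_iff₀ (by positivity)]
    refine le_of_mul_le_mul_right ?_ hr
    linarith
  · have h := uniformSphere_closedBall_le (by omega) c hr hr1 (ρ := 3 * r) (by linarith)
    rw [show r + 3 * r = 4 * r by ring, mul_pow, pow_succ r] at h
    rw [Nat.add_sub_cancel]
    refine le_of_mul_le_mul_right ?_ hr
    linarith

theorem lintegral_numFacets_le_of_cap_bounds {n : ℕ} (hn : 2 ≤ n) {α β : ℝ} (hα : 0 < α)
    (hβ : 0 < β) {r : ℝ} (hr : 0 < r) (hr' : r ≤ 1 / 2)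
    (hlow : ∀ c : UnitSphere n,
      α * r ^ (n - 1) ≤ (uniformSphere n).real (Metric.closedBall c (r / 2)))
    (hup : ∀ c : UnitSphere n,
      (uniformSphere n).real (Metric.closedBall c (3 * r)) ≤ β * r ^ (n - 1)) (m : ℕ) :
    ∫⁻ a : Fin m → UnitSphere n, numFacets a ∂(randomPoints n m) ≤
      ENNReal.ofReal ((m : ℝ) ^ n / (α * r ^ (n - 1)) *
        ((β * r ^ (n - 1)) ^ n + Real.exp (-(α * r ^ (n - 1) * m)))) := by
  have : IsProbabilityMeasure (uniformSphere n) :=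
    isProbabilityMeasure_uniformSphere n (by omega)
  have hq : 0 < α * r ^ (n - 1) := by positivity
  obtain ⟨C, hcov, hC⟩ := exists_finset_net (uniformSphere n) hr hq hlow
  have : Nonempty (UnitSphere n) := by
    by_contra hne
    rw [not_nonempty_iff] at hne
    have h := measure_univ (μ := uniformSphere n)
    rw [Set.univ_eq_empty_iff.2 hne] at h
    simp at h
  obtain ⟨c₀⟩ := this
  have hq1 : α * r ^ (n - 1) ≤ 1 := (hlow c₀).trans measureReal_le_one
  refine (lintegral_numFacets_le (by omega) hr.le hr' hcov (p := β * r ^ (n - 1)) (by positivity)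
    hup (fun c => (hlow c).trans (measureReal_mono (Metric.closedBall_subset_closedBall
      (by linarith)))) hq1).trans (ENNReal.ofReal_le_ofReal ?_)
  have hexp : (1 - α * r ^ (n - 1)) ^ m ≤ Real.exp (-(α * r ^ (n - 1) * m)) := by
    rw [show -(α * r ^ (n - 1) * m) = m * (-(α * r ^ (n - 1))) by ring, Real.exp_nat_mul]
    exact pow_le_pow_left₀ (by linarith) (Real.one_sub_le_exp_neg _) m
  have hC' : (C.card : ℝ) ≤ 1 / (α * r ^ (n - 1)) := (le_div_iff₀ hq).2 hC
  calc (m : ℝ) ^ n * (C.card * ((β * r ^ (n - 1)) ^ n + (1 - α * r ^ (n - 1)) ^ m))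
      ≤ (m : ℝ) ^ n * (1 / (α * r ^ (n - 1)) *
        ((β * r ^ (n - 1)) ^ n + Real.exp (-(α * r ^ (n - 1) * m)))) := by
        gcongr
    _ = _ := by ring

/-! ### Measurability of the number of facets -/

section Measurability

variable {n m : ℕ}

/-- The span of finitely many points has dimension at least `d` if and only if `d + 1` of the points
are affinely independent. -/
theorem le_finrank_vectorSpan_iff {V : Type*} [AddCommGroup V] [Module ℝ V] {ι : Type*} [Finite ι]
    (p : ι → V) {J : Set ι} (hJ : J.Nonempty) (d : ℕ) :
    d ≤ Module.finrank ℝ (vectorSpan ℝ (p '' J)) ↔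
      ∃ T : Fin (d + 1) → J, AffineIndependent ℝ fun k => p (T k) := by
  have hfd : FiniteDimensional ℝ (vectorSpan ℝ (p '' J)) :=
    finiteDimensional_vectorSpan_of_finite ℝ ((Set.toFinite J).image p)
  constructor
  · intro hd
    obtain ⟨S, hSsub, hSspan, hSind⟩ := exists_affineIndependent ℝ V (p '' J)
    have hSfin : S.Finite := ((Set.toFinite J).image p).subset hSsub
    have hSne : S.Nonempty := by
      rw [← affineSpan_nonempty (k := ℝ), hSspan, affineSpan_nonempty]
      exact hJ.image p
    have : Fintype S := hSfin.fintype
    have : Nonempty S := hSne.to_subtype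
    have hcard : Fintype.card (Fin (d + 1)) ≤ Fintype.card S := by
      have := hSind.finrank_vectorSpan_add_one
      rw [Subtype.range_coe, ← direction_affineSpan, hSspan, direction_affineSpan] at this
      rw [← this, Fintype.card_fin]
      omega
    obtain ⟨e⟩ := Function.Embedding.nonempty_of_card_le hcard
    choose T hTJ hT using fun k => hSsub (e k).2
    refine ⟨fun k => ⟨T k, hTJ k⟩, ?_⟩
    simp only [hT]
    exact hSind.comp_embedding e
  · rintro ⟨T, hT⟩
    rw [← hT.finrank_vectorSpan (Fintype.card_fin _)]
    refine Submodule.finrank_mono (vectorSpan_mono ℝ ?_)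
    rintro _ ⟨k, rfl⟩
    exact ⟨T k, (T k).2, rfl⟩

theorem measurable_finrank_vectorSpan {J : Set (Fin m)} (hJ : J.Nonempty) :
    Measurable fun a : Fin m → UnitSphere n =>
      Module.finrank ℝ (vectorSpan ℝ ((fun i => (a i : EuclideanSpace ℝ (Fin n))) '' J)) := by
  refine measurable_of_Ici fun d => IsOpen.measurableSet ?_
  have : (fun a : Fin m → UnitSphere n => Module.finrank ℝ
      (vectorSpan ℝ ((fun i => (a i : EuclideanSpace ℝ (Fin n))) '' J))) ⁻¹' Set.Ici d =
      ⋃ T : Fin (d + 1) → J, (fun (a : Fin m → UnitSphere n) k =>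
        (a (T k) : EuclideanSpace ℝ (Fin n))) ⁻¹' {p | AffineIndependent ℝ p} := by
    ext a
    simp [le_finrank_vectorSpan_iff _ hJ]
  rw [this]
  exact isOpen_iUnion fun T =>
    (isOpen_setOfPred_affineIndependent (𝕜 := ℝ)).preimage (by fun_prop)

/-- The affine hyperplane `inner ℝ v x = k` passes through the points `p i` with `i ∈ J`, and all
other points lie strictly on one side of it. Strictness is normalized to a gap of `1` by scaling
`v` and `k`, so that the condition is closed. The degenerate case `v = 0` is allowed and occurs only
for `k = 0` and `J = univ`, or for `J = ∅`. -/
def IsSupporting {E ι : Type*} [NormedAddCommGroup E] [InnerProductSpace ℝ E]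
    (p : ι → E) (J : Set ι) (v : E) (k : ℝ) : Prop :=
  (∀ i ∈ J, inner ℝ v (p i) = k) ∧ ∀ i ∉ J, inner ℝ v (p i) ≤ k - 1

/-- With `(v, k)` restricted to a compact ball the set is a projection of a compact set. -/
theorem measurableSet_exists_isSupporting (J : Set (Fin m)) :
    MeasurableSet {a : Fin m → UnitSphere n |
      ∃ v k, IsSupporting (fun i => (a i : EuclideanSpace ℝ (Fin n))) J v k} := by
  set R : Set ((EuclideanSpace ℝ (Fin n) × ℝ) × (Fin m → UnitSphere n)) :=
    {z | IsSupporting (fun i => (z.2 i : EuclideanSpace ℝ (Fin n))) J z.1.1 z.1.2} with hR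
  have hRc : IsClosed R := by
    have : R = (⋂ i ∈ J, {z | inner ℝ z.1.1 (z.2 i : EuclideanSpace ℝ (Fin n)) = z.1.2}) ∩
        ⋂ i ∈ Jᶜ, {z | inner ℝ z.1.1 (z.2 i : EuclideanSpace ℝ (Fin n)) ≤ z.1.2 - 1} := by
      ext z
      simp [hR, IsSupporting]
    rw [this]
    refine IsClosed.inter (isClosed_biInter fun i _ => isClosed_eq ?_ ?_)
      (isClosed_biInter fun i _ => isClosed_le ?_ ?_) <;> fun_prop
  have : {a : Fin m → UnitSphere n |
      ∃ v k, IsSupporting (fun i => (a i : EuclideanSpace ℝ (Fin n))) J v k} =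
      ⋃ N : ℕ, Prod.snd '' ((Metric.closedBall 0 (N : ℝ) ×ˢ Set.univ) ∩ R) := by
    ext a
    simp only [Set.mem_ofPred_eq, Set.mem_iUnion, Set.mem_image]
    constructor
    · rintro ⟨v, k, h⟩
      obtain ⟨N, hN⟩ := exists_nat_ge ‖(v, k)‖
      exact ⟨N, ((v, k), a), ⟨⟨by simpa using hN, trivial⟩, h⟩, rfl⟩
    · rintro ⟨N, ⟨⟨v, k⟩, b⟩, ⟨-, h⟩, rfl⟩
      exact ⟨v, k, h⟩
  rw [this]
  refine MeasurableSet.iUnion fun N => IsClosed.measurableSet (IsCompact.isClosed ?_)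
  exact (((isCompact_closedBall _ _).prod isCompact_univ).inter_right hRc).image continuous_snd

section Support

variable {E ι : Type*} [NormedAddCommGroup E] [InnerProductSpace ℝ E] [Finite ι]
  {p : ι → E} {J : Set ι} {v : E} {k : ℝ}

/-- The points on a supporting hyperplane span a face, which contains no other points `p i`. -/
theorem IsSupporting.isExposed (h : IsSupporting p J v k) (hJ : J.Nonempty) :
    IsExposed ℝ (convexHull ℝ (Set.range p)) (convexHull ℝ (p '' J)) ∧
      {i | p i ∈ convexHull ℝ (p '' J)} = J := by
  set F := (innerSL ℝ v).toExposed (convexHull ℝ (Set.range p)) with hF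
  have hFexp : IsExposed ℝ (convexHull ℝ (Set.range p)) F :=
    ContinuousLinearMap.toExposed.isExposed
  have hle : ∀ i, inner ℝ v (p i) ≤ k := fun i => by
    by_cases hi : i ∈ J
    · exact (h.1 i hi).le
    · linarith [h.2 i hi]
  have hleP : ∀ y ∈ convexHull ℝ (Set.range p), inner ℝ v y ≤ k := by
    have hsub : convexHull ℝ (Set.range p) ⊆ {y | innerSL ℝ v y ≤ k} :=
      convexHull_min (by rintro _ ⟨i, rfl⟩; exact hle i)
        (convex_halfSpace_le (innerSL ℝ v).isLinear k)
    exact hsub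
  have hFJ : {i | p i ∈ F} = J := by
    ext i
    refine ⟨fun hi => ?_, fun hi => ⟨subset_convexHull ℝ _ (Set.mem_range_self i), fun y hy => ?_⟩⟩
    · obtain ⟨j, hj⟩ := hJ
      by_contra hiJ
      have h1 : inner ℝ v (p j) ≤ inner ℝ v (p i) :=
        hi.2 _ (subset_convexHull ℝ _ (Set.mem_range_self j))
      rw [h.1 j hj] at h1
      linarith [h.2 i hiJ]
    · change inner ℝ v y ≤ inner ℝ v (p i)
      rw [h.1 i hi]
      exact hleP y hy
  have hconv := convexHull_eq_of_isExposed p hFexp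
  rw [hFJ] at hconv
  rw [hconv]
  exact ⟨hFexp, hFJ⟩

theorem exists_isSupporting_of_isExposed [CompleteSpace E] {F : Set E}
    (hF : IsExposed ℝ (convexHull ℝ (Set.range p)) F) (hne : F.Nonempty) :
    ∃ v k, IsSupporting p {i | p i ∈ F} v k := by
  obtain ⟨l, hl⟩ := hF hne
  set v := (InnerProductSpace.toDual ℝ E).symm l with hvdef
  have hlv : ∀ x, inner ℝ v x = l x := fun x => by
    rw [hvdef, InnerProductSpace.toDual_symm_apply]
  obtain ⟨x, hx⟩ := hne
  have hx' := hx
  rw [hl] at hx'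
  have hlt : ∀ i, p i ∉ F → l (p i) < l x := fun i hi => by
    have hiP := subset_convexHull ℝ _ (Set.mem_range_self (f := p) i)
    refine lt_of_le_of_ne (hx'.2 _ hiP) fun heq => hi ?_
    rw [hl]
    exact ⟨hiP, fun y hy => heq ▸ hx'.2 y hy⟩
  -- A large multiple of `v` turns the finitely many strict inequalities into a gap of `1`.
  have hev : ∀ᶠ N : ℕ in atTop, ∀ i, p i ∉ F → 1 ≤ (N : ℝ) * (l x - l (p i)) := by
    rw [eventually_all]
    intro i
    by_cases hi : p i ∈ F
    · exact Eventually.of_forall fun _ h => absurd hi h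
    · have := (tendsto_natCast_atTop_atTop (R := ℝ)).atTop_mul_const (sub_pos.2 (hlt i hi))
      filter_upwards [this.eventually_ge_atTop 1] with N hN _ using hN
  obtain ⟨N, hN⟩ := hev.exists
  refine ⟨(N : ℝ) • v, N * l x, fun i hi => ?_, fun i hi => ?_⟩
  · have hi' : p i ∈ F := hi
    rw [hl] at hi'
    rw [real_inner_smul_left, hlv, le_antisymm (hx'.2 _ hi'.1) (hi'.2 _ hx'.1)]
  · rw [real_inner_smul_left, hlv]
    linarith [hN i hi]

end Support

/-- `J` is the set of all indices of points of `a` that lie in some given facet of the polytope. -/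
def IsFacetIndexSet (a : Fin m → UnitSphere n) (J : Set (Fin m)) : Prop :=
  J.Nonempty ∧ (∃ v k, IsSupporting (fun i => (a i : EuclideanSpace ℝ (Fin n))) J v k) ∧
    Module.finrank ℝ (vectorSpan ℝ ((fun i => (a i : EuclideanSpace ℝ (Fin n))) '' J)) + 1 =
      Module.finrank ℝ (vectorSpan ℝ ((fun i => (a i : EuclideanSpace ℝ (Fin n))) '' Set.univ))

theorem measurableSet_isFacetIndexSet (J : Set (Fin m)) :
    MeasurableSet {a : Fin m → UnitSphere n | IsFacetIndexSet a J} := by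
  by_cases hJ : J.Nonempty
  · have hu : (Set.univ : Set (Fin m)).Nonempty := hJ.mono (Set.subset_univ _)
    simp only [IsFacetIndexSet, hJ, true_and]
    exact (measurableSet_exists_isSupporting J).inter (measurableSet_eq_fun
      ((measurable_finrank_vectorSpan hJ).add_const 1) (measurable_finrank_vectorSpan hu))
  · simp [IsFacetIndexSet, hJ]

/-- Facets correspond to their index sets, through `J ↦ conv {a i | i ∈ J}`. -/
theorem encard_facets_polytope (a : Fin m → UnitSphere n) :
    (facets (polytope a)).encard = {J | IsFacetIndexSet a J}.encard := by
  have himage : facets (polytope a) =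
      (fun J => convexHull ℝ ((fun i => (a i : EuclideanSpace ℝ (Fin n))) '' J)) ''
        {J | IsFacetIndexSet a J} := by
    ext F
    constructor
    · rintro ⟨hne, hexp, hdim⟩
      have hconv := convexHull_eq_of_isExposed _ hexp
      refine ⟨{i | (a i : EuclideanSpace ℝ (Fin n)) ∈ F}, ⟨?_,
        exists_isSupporting_of_isExposed hexp hne, ?_⟩, hconv⟩
      · rw [← hconv, convexHull_nonempty_iff] at hne
        exact hne.of_image
      · rw [← vectorSpan_convexHull, hconv, hdim, polytope, vectorSpan_convexHull, Set.image_univ]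
    · rintro ⟨J, ⟨hJ, ⟨v, k, h⟩, hdim⟩, rfl⟩
      refine ⟨(hJ.image _).convexHull, (h.isExposed hJ).1, ?_⟩
      rw [vectorSpan_convexHull, hdim, polytope, vectorSpan_convexHull, Set.image_univ]
  rw [himage, Set.InjOn.encard_image]
  rintro J ⟨hJ, ⟨v, k, h⟩, -⟩ J' ⟨hJ', ⟨v', k', h'⟩, -⟩ heq
  rw [← (h.isExposed hJ).2, ← (h'.isExposed hJ').2]
  simp only at heq
  rw [heq]

theorem measurable_numFacets : Measurable (numFacets : (Fin m → UnitSphere n) → ℝ≥0∞) := by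
  classical
  have : (numFacets : (Fin m → UnitSphere n) → ℝ≥0∞) = fun a =>
      ∑ J : Set (Fin m), {b | IsFacetIndexSet b J}.indicator 1 a := by
    funext a
    have hfin : {J | IsFacetIndexSet a J}.encard =
        (Finset.univ.filter fun J => IsFacetIndexSet a J).card := by
      rw [← Set.encard_coe_eq_coe_finsetCard]
      simp
    rw [numFacets, encard_facets_polytope, hfin]
    simp [Set.indicator_apply, Finset.sum_boole]
  rw [this]
  exact Finset.measurable_fun_sum _ fun J _ =>
    measurable_one.indicator (measurableSet_isFacetIndexSet J)

end Measurability

/-! ### The choice of the scale -/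

theorem eventually_mul_log_div_le (A : ℝ) {ε : ℝ} (hε : 0 < ε) :
    ∀ᶠ m : ℕ in atTop, A * Real.log m / m ≤ ε := by
  have h := (Real.tendsto_pow_log_div_mul_add_atTop 1 0 1 one_ne_zero).const_mul A
  have h2 := h.comp (tendsto_natCast_atTop_atTop (R := ℝ))
  rw [mul_zero] at h2
  filter_upwards [h2.eventually_le_const hε] with m hm
  simpa [mul_div_assoc] using hm

end RandomPolytope

theorem mainTheorem1 (n : ℕ) (hn : 2 ≤ n) :
    ∃ C : ℝ, 0 < C ∧ ∀ᶠ m : ℕ in atTop,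
      AEMeasurable (fun a : Fin m → RandomPolytope.UnitSphere n => RandomPolytope.numFacets a)
        (RandomPolytope.randomPoints n m) ∧
      ∫⁻ a : Fin m → RandomPolytope.UnitSphere n, RandomPolytope.numFacets a
          ∂(RandomPolytope.randomPoints n m) ≤
        ENNReal.ofReal (C * (Real.log (m : ℝ)) ^ (n - 1) * (m : ℝ)) := by
  obtain ⟨α, β, hα, hβ, hcap⟩ := RandomPolytope.exists_cap_bounds n hn
  have hn0 : (0 : ℝ) < n := by positivity
  -- With this value of `A` the probability that a given cap is empty is at most `m ^ (-n)`.
  set A : ℝ := n / α with hA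
  have hApos : 0 < A := by positivity
  refine ⟨β ^ n / α * A ^ (n - 1) + 1, by positivity, ?_⟩
  filter_upwards [RandomPolytope.eventually_mul_log_div_le A (ε := (1 / 2) ^ (n - 1))
    (by positivity), eventually_ge_atTop 3] with m hm hm3
  refine ⟨RandomPolytope.measurable_numFacets.aemeasurable, ?_⟩
  have hm0 : (0 : ℝ) < m := by positivity
  have hm3' : (3 : ℝ) ≤ m := by exact_mod_cast hm3
  have hlog : 1 ≤ Real.log m := by
    rw [Real.le_log_iff_exp_le hm0]
    linarith [Real.exp_one_lt_d9]
  set L := Real.log m with hL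
  have hx : 0 < A * L / m := by positivity
  set r := (A * L / m) ^ ((n - 1 : ℕ) : ℝ)⁻¹ with hrdef
  have hr : 0 < r := Real.rpow_pos_of_pos hx _
  have hrpow : r ^ (n - 1) = A * L / m := Real.rpow_inv_natCast_pow hx.le (by omega)
  have hr' : r ≤ 1 / 2 := by
    rw [← hrpow] at hm
    exact le_of_pow_le_pow_left₀ (by omega) (by norm_num) hm
  refine (RandomPolytope.lintegral_numFacets_le_of_cap_bounds hn hα hβ hr hr'
    (fun c => (hcap r hr (by linarith) c).1) (fun c => (hcap r hr (by linarith) c).2) m).trans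
    (ENNReal.ofReal_le_ofReal ?_)
  rw [hrpow]
  have hexp : Real.exp (-(α * (A * L / m) * m)) = ((m : ℝ) ^ n)⁻¹ := by
    rw [show α * (A * L / m) * m = n * L by rw [hA]; field_simp, Real.exp_neg, Real.exp_nat_mul,
      Real.exp_log hm0]
  rw [hexp, mul_add]
  have h1 : (m : ℝ) ^ n / (α * (A * L / m)) * (β * (A * L / m)) ^ n =
      β ^ n / α * A ^ (n - 1) * L ^ (n - 1) * m := by
    obtain ⟨d, rfl⟩ : ∃ d, n = d + 1 := ⟨n - 1, by omega⟩
    have : L ≠ 0 := by positivity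
    rw [Nat.add_sub_cancel, mul_pow, div_pow, mul_pow]
    clear_value A
    field_simp
    ring
  have h2 : (m : ℝ) ^ n / (α * (A * L / m)) * ((m : ℝ) ^ n)⁻¹ ≤ L ^ (n - 1) * m := by
    have : (m : ℝ) ^ n / (α * (A * L / m)) * ((m : ℝ) ^ n)⁻¹ = m / (n * L) := by
      rw [hA]
      field_simp
    rw [this]
    calc (m : ℝ) / (n * L) ≤ m := by
          refine div_le_self hm0.le ?_
          have : (2 : ℝ) ≤ n := by exact_mod_cast hn
          nlinarith
      _ ≤ L ^ (n - 1) * m := le_mul_of_one_le_left hm0.le (one_le_pow₀ hlog)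
  linarith
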